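/- All Hilbert spaces are finite-dimensional and are written as $\mathbb{C}^A$ for a finite set $A$. A quantum channel is a completely positive trace-preserving linear map between the operator algebras of two such spaces, and a POVM is a finite family of positive semidefinite operators that sum to the identity. A quantum encryption of classical messages (QECM) is a tuple $Q=(M,K,\pi,H,\{\sigma^k_m\}_{k\in K,m\in M})$, where $M$ is a finite set of messages, $K$ is a measurable space of keys, $\pi$ is a probability measure on $K$, $H$ is a Hilbert space and the $\sigma^k_m$ are density operators on $H$, measurable in $k$. It is correct if there are POVMs $\{P^k_m\}_{m\in M}$ on $H$, $k\in K$, with $\int_K\operatorname{Tr}(P^k_m\sigma^k_m)\,d\pi(k)\ge 1$ for every $m\in M$. Let $N,s\in\mathbb{N}$ and let $\mathscr{F}$ be a class of quantum channels. A $1$-to-$s$ $N$-message cloning attack over $\mathscr{F}$ against $Q$ is a tuple $\mathcal A=(M_0,\{B_i\}_{i=1}^s,\{P^{i,k}_m\},\Phi)$, where $M_0\subseteq M$ has exactly $N$ elements, the $B_i$ are Hilbert spaces, $\{P^{i,k}_m\}_{m\in M_0}$ is a POVM on $B_i$ for all $i$ and $k$, measurable in $k$, and $\Phi:\mathcal{B}(H)\to\mathcal{B}(B_1\otimes\cdots\otimes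 B_s)$ is a channel in $\mathscr{F}$. The $1$-to-$s$ $N$-message cloning value of $Q$ over $\mathscr{F}$ is $$\mathfrak{c}^N_{1\to s}(Q|\mathscr{F})=\sup_{\mathcal A}\int_K\frac1N\sum_{m\in M_0}\operatorname{Tr}\big[(P^{1,k}_m\otimes\cdots\otimes P^{s,k}_m)\,\Phi(\sigma^k_m)\big]\,d\pi(k),$$ the supremum being over all such attacks (and $0$ if there are none). For $r\ge 1$ and $n\ge 0$, the rank-$r$ Haar-measure encryption of $n$ messages is the QECM $Q_{r,n}$ with messages $\{0,\dots,n-1\}$, keys $U$ in the unitary group $\mathcal{U}(rn)$ distributed by the Haar probability measure, codespace $\mathbb{C}^{rn}$ with basis $|0\rangle,\dots,|rn-1\rangle$, and ciphertexts $U\sigma_iU^*$, where $\sigma_i=\frac1r\sum_{j=ri}^{r(i+1)-1}|j\rangle\langle j|$. **Theorem.** Let $Q=(M,K,\pi,H,\{\sigma^k_m\})$ be a correct QECM and let $\mathscr{F}$ be a class of quantum channels such that for every $\Phi\in\mathscr{F}$ and every isometry $V$ into the input space of $\Phi$, the channel $\rho\mapsto\Phi(V\rho V^*)$ is in $\mathscr{F}$.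 Then, with $n=|M|$ and $r=\dim H-|M|+1$ (which is at least $1$, since $Q$ is correct), for all $N,s\in\mathbb{N}$, $$\mathfrak{c}^N_{1\to s}(Q_{r,n}|\mathscr{F})\le\mathfrak{c}^N_{1\to s}(Q|\mathscr{F}).$$ -/

import Mathlib

open MeasureTheory Matrix
open scoped ComplexOrder

namespace QEnc

noncomputable section

/-! Every (finite-dimensional) Hilbert space is written as `ℂ^A` for a finite set `A`, a register;
operators from `ℂ^A` to `ℂ^B` are the matrices with rows indexed by `B` and columns by `A`. -/

/-- Density operators on `ℂ^A`. -/
def IsState {A : Type} [Fintype A] (ρ : Matrix A A ℂ) : Prop :=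
  ρ.PosSemidef ∧ ρ.trace = 1

/-- A POVM on `ℂ^B` with outcomes in the finite set `ι`. -/
def IsPOVM {ι : Type*} [Fintype ι] {B : Type} [Fintype B] [DecidableEq B]
    (P : ι → Matrix B B ℂ) : Prop :=
  (∀ m, (P m).PosSemidef) ∧ ∑ m, P m = 1

/-- The map `Φ ⊗ id_k` on operators on `ℂ^A ⊗ ℂ^k`: it applies `Φ` to each of the `k × k` blocks. -/
def ampliation {A B : Type} (Φ : Matrix A A ℂ →ₗ[ℂ] Matrix B B ℂ) (k : ℕ)
    (X : Matrix (A × Fin k) (A × Fin k) ℂ) : Matrix (B × Fin k) (B × Fin k) ℂ :=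
  Matrix.of fun p q => Φ (Matrix.of fun a a' => X (a, p.2) (a', q.2)) p.1 q.1

/-- Quantum channels: completely positive trace-preserving maps `B(ℂ^A) → B(ℂ^B)`. -/
structure Channel (A B : Type) [Fintype A] [Fintype B] where
  toLin : Matrix A A ℂ →ₗ[ℂ] Matrix B B ℂ
  completelyPositive : ∀ (k : ℕ) (X : Matrix (A × Fin k) (A × Fin k) ℂ),
    X.PosSemidef → (ampliation toLin k X).PosSemidef
  tracePreserving : ∀ X : Matrix A A ℂ, (toLin X).trace = X.trace

/-- The linear map `ρ ↦ V ρ V*`. -/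
def conj {A A' : Type} [Fintype A] (V : Matrix A' A ℂ) :
    Matrix A A ℂ →ₗ[ℂ] Matrix A' A' ℂ where
  toFun X := V * X * Vᴴ
  map_add' X Y := by rw [Matrix.mul_add, Matrix.add_mul]
  map_smul' c X := by simp

theorem ampliation_conj {A A' : Type} [Fintype A] (V : Matrix A' A ℂ) (k : ℕ)
    (X : Matrix (A × Fin k) (A × Fin k) ℂ) :
    ampliation (conj V) k X =
      Matrix.kroneckerMap (· * ·) V (1 : Matrix (Fin k) (Fin k) ℂ) * X *
        (Matrix.kroneckerMap (· * ·) V (1 : Matrix (Fin k) (Fin k) ℂ))ᴴ := by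
  ext ⟨b, i⟩ ⟨b', j⟩
  simp [ampliation, conj, Matrix.mul_apply, Fintype.sum_prod_type, Matrix.one_apply,
    Finset.sum_ite_eq, apply_ite]

/-- The channel `ρ ↦ Φ(V ρ V*)` for an isometry `V : ℂ^A → ℂ^A'`. -/
def Channel.preIsometry {A A' B : Type} [Fintype A] [DecidableEq A] [Fintype A'] [Fintype B]
    (Φ : Channel A' B) (V : Matrix A' A ℂ) (hV : Vᴴ * V = 1) : Channel A B where
  toLin := Φ.toLin ∘ₗ conj V
  completelyPositive k X hX := by
    have h : (ampliation (conj V) k X).PosSemidef := by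
      rw [ampliation_conj]
      exact hX.mul_mul_conjTranspose_same _
    exact Φ.completelyPositive k _ h
  tracePreserving X := by
    have h : (V * X * Vᴴ).trace = X.trace := by
      rw [Matrix.trace_mul_comm, ← Matrix.mul_assoc, hV, Matrix.one_mul]
    exact (Φ.tracePreserving _).trans h

/-- A class of quantum channels. -/
def ChannelClass : Type 1 :=
  ∀ (A B : Type) [Fintype A] [Fintype B], Set (Channel A B)

/-- The class is closed under `Φ ↦ Φ(V · V*)` for every isometry `V`. -/
def ChannelClass.ClosedUnderIsometries (F : ChannelClass) : Prop :=
  ∀ (A A' B : Type) [Fintype A] [DecidableEq A] [Fintype A'] [Fintype B]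
    (Φ : Channel A' B) (V : Matrix A' A ℂ) (hV : Vᴴ * V = 1),
    Φ ∈ F A' B → Φ.preIsometry V hV ∈ F A B

/-- A quantum encryption of classical messages with set of messages `M`, space of keys `K` and
codespace `ℂ^A`. -/
structure QECM (M : Type*) (K : Type*) [MeasurableSpace K] (A : Type) [Fintype A] where
  /-- the key distribution -/
  keyDist : Measure K
  isProb : IsProbabilityMeasure keyDist
  /-- the ciphertexts -/
  cipher : K → M → Matrix A A ℂ
  isState : ∀ k m, IsState (cipher k m)
  measurable_cipher : ∀ m a a', Measurable fun k => cipher k m a a'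

/-- `ε`-correctness. For `ε < 1` the inequality forces the integrand to be integrable, since the
integral would otherwise be `0`. -/
def QECM.IsEpsCorrect {M K : Type*} [Fintype M] [MeasurableSpace K] {A : Type} [Fintype A]
    [DecidableEq A] (Q : QECM M K A) (ε : ℝ) : Prop :=
  ∃ P : K → M → Matrix A A ℂ, (∀ k, IsPOVM (P k)) ∧
    ∀ m, 1 - ε ≤ ∫ k, (P k m * Q.cipher k m).trace.re ∂Q.keyDist

/-- Correctness is `0`-correctness. -/
def QECM.IsCorrect {M K : Type*} [Fintype M] [MeasurableSpace K] {A : Type} [Fintype A]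
    [DecidableEq A] (Q : QECM M K A) : Prop :=
  Q.IsEpsCorrect 0

/-- The tensor product `P₀ ⊗ ⋯ ⊗ P₍ₛ₋₁₎` of operators `Pᵢ` on `ℂ^(B i)`, an operator on
`ℂ^(B 0) ⊗ ⋯ ⊗ ℂ^(B (s-1)) = ℂ^(B 0 × ⋯ × B (s-1))`. -/
def tensor {s : ℕ} {B : Fin s → Type} (P : ∀ i, Matrix (B i) (B i) ℂ) :
    Matrix (∀ i, B i) (∀ i, B i) ℂ :=
  Matrix.of fun x y => ∏ i, P i (x i) (y i)

/-- A `1`-to-`s` `N`-message cloning attack over `F` against a QECM with messages `M`, keys `K` and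
codespace `ℂ^A`. -/
structure Attack (M K : Type*) [MeasurableSpace K] (A : Type) [Fintype A]
    (F : ChannelClass) (N s : ℕ) where
  M₀ : Finset M
  card_M₀ : M₀.card = N
  /-- the registers of the receivers -/
  B : Fin s → Type
  fintypeB : ∀ i, Fintype (B i)
  decEqB : ∀ i, DecidableEq (B i)
  /-- the measurement of each receiver, given the key -/
  P : ∀ i, K → M₀ → Matrix (B i) (B i) ℂ
  isPOVM : ∀ i k, IsPOVM (P i k)
  measurable_P : ∀ i m b b', Measurable fun k => P i k m b b'
  Φ : Channel A (∀ i, B i)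
  mem : Φ ∈ F A (∀ i, B i)

/-- The cloning probability of an attack against a QECM. -/
def QECM.attackValue {M K : Type*} [MeasurableSpace K] {A : Type} [Fintype A]
    (Q : QECM M K A) {F : ChannelClass} {N s : ℕ} (𝒜 : Attack M K A F N s) : ℝ :=
  letI := 𝒜.fintypeB
  ∫ k, (1 / (N : ℝ)) * ∑ m : 𝒜.M₀,
    (tensor (fun i => 𝒜.P i k m) * 𝒜.Φ.toLin (Q.cipher k m)).trace.re ∂Q.keyDist

/-- The `1`-to-`s` `N`-message cloning value over `F`: the supremum of the cloning probabilities
(numbers in `[0, 1]`) over all attacks, which is `0` when there is no attack. -/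
def QECM.cloningValue {M K : Type*} [MeasurableSpace K] {A : Type} [Fintype A]
    (Q : QECM M K A) (F : ChannelClass) (N s : ℕ) : ℝ :=
  ⨆ 𝒜 : Attack M K A F N s, Q.attackValue 𝒜

/-! ### The Haar-measure encryption -/

instance unitaryMeasurableSpace (d : ℕ) : MeasurableSpace (unitaryGroup (Fin d) ℂ) := borel _

instance unitaryBorelSpace (d : ℕ) : BorelSpace (unitaryGroup (Fin d) ℂ) := ⟨rfl⟩

instance unitaryCompactSpace (d : ℕ) : CompactSpace (unitaryGroup (Fin d) ℂ) := by
  refine (isCompact_iff_compactSpace (s := (unitaryGroup (Fin d) ℂ : Set (Matrix (Fin d) (Fin d) ℂ)))).mp ?_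
  have hK : IsCompact (Set.univ.pi fun _ : Fin d => Set.univ.pi fun _ : Fin d =>
      Metric.closedBall (0 : ℂ) 1) :=
    isCompact_univ_pi fun _ => isCompact_univ_pi fun _ => isCompact_closedBall _ _
  refine IsCompact.of_isClosed_subset (X := Matrix (Fin d) (Fin d) ℂ) hK isClosed_unitary ?_
  intro U hU i _ j _
  simpa using entry_norm_bound_of_unitary hU i j

/-- The Haar probability measure on the unitary group `U(d)`. -/
def haarUnitary (d : ℕ) : Measure (unitaryGroup (Fin d) ℂ) :=
  Measure.haarMeasure ⊤

instance haarUnitary_isProb (d : ℕ) : IsProbabilityMeasure (haarUnitary d) :=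
  ⟨by simpa using! Measure.haarMeasure_self (K₀ := (⊤ : TopologicalSpace.PositiveCompacts
    (unitaryGroup (Fin d) ℂ)))⟩

/-- The state `(1/r) ∑_{j = r i}^{r (i + 1) - 1} |j⟩⟨j|` on `ℂ^(r n)`. -/
def blockState (r n : ℕ) (i : Fin n) : Matrix (Fin (r * n)) (Fin (r * n)) ℂ :=
  Matrix.diagonal fun j => if r * i.val ≤ j.val ∧ j.val < r * (i.val + 1) then (r : ℂ)⁻¹ else 0

theorem blockState_isState (r n : ℕ) [NeZero r] (i : Fin n) : IsState (blockState r n i) := by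
  constructor
  · refine PosSemidef.diagonal fun j => ?_
    dsimp only
    split_ifs
    · simp
    · exact le_rfl
  · have hle : r * (i.val + 1) ≤ r * n := Nat.mul_le_mul_left r i.isLt
    rw [blockState, Matrix.trace_diagonal, Fin.sum_univ_eq_sum_range
      (fun j => if r * i.val ≤ j ∧ j < r * (i.val + 1) then (r : ℂ)⁻¹ else 0) (r * n),
      ← Finset.sum_filter]
    have hf : (Finset.range (r * n)).filter (fun j => r * i.val ≤ j ∧ j < r * (i.val + 1)) =
        Finset.Ico (r * i.val) (r * (i.val + 1)) := by
      ext j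
      simp only [Finset.mem_filter, Finset.mem_range, Finset.mem_Ico]
      omega
    have hr : (r : ℂ) ≠ 0 := Nat.cast_ne_zero.mpr (NeZero.ne r)
    rw [hf, Finset.sum_const, Nat.card_Ico, Nat.mul_succ, Nat.add_sub_cancel_left, nsmul_eq_mul,
      mul_inv_cancel₀ hr]

/-- The rank-`r` Haar-measure encryption of `n` messages. -/
def haarEncryption (r n : ℕ) [NeZero r] :
    QECM (Fin n) (unitaryGroup (Fin (r * n)) ℂ) (Fin (r * n)) where
  keyDist := haarUnitary (r * n)
  isProb := inferInstance
  cipher U i := (U : Matrix (Fin (r * n)) (Fin (r * n)) ℂ) * blockState r n i *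
    (U : Matrix (Fin (r * n)) (Fin (r * n)) ℂ)ᴴ
  isState U i := by
    refine ⟨(blockState_isState r n i).1.mul_mul_conjTranspose_same _, ?_⟩
    have hU : (U : Matrix (Fin (r * n)) (Fin (r * n)) ℂ)ᴴ * U = 1 := mem_unitaryGroup_iff'.mp U.2
    rw [Matrix.trace_mul_comm, ← Matrix.mul_assoc, hU, Matrix.one_mul]
    exact (blockState_isState r n i).2
  measurable_cipher i a a' := by
    refine Continuous.measurable ?_
    have h : Continuous fun U : unitaryGroup (Fin (r * n)) ℂ =>
        (U : Matrix (Fin (r * n)) (Fin (r * n)) ℂ) * blockState r n i *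
          (U : Matrix (Fin (r * n)) (Fin (r * n)) ℂ)ᴴ :=
      (continuous_subtype_val.matrix_mul continuous_const).matrix_mul
        continuous_subtype_val.matrix_conjTranspose
    exact h.matrix_elem a a'

end

end QEnc

/-!
Correctness forces the ciphertexts of almost every key to be mutually orthogonal, so each has rank
at most `r = dim H - |M| + 1`. Embed the codespace in `ℂ^(r n)` by an isometry `V`. There the
ciphertexts of a key `k` have a common eigenbasis, grouped into `n` blocks of `r` vectors that carry
one message each, and composing it with the `r` cyclic shifts inside the blocks gives unitaries
`G_t(k)` with `∑_t G_t(k) V σ_m^k V* G_t(k)* = r σ_m`, where `σ_m` are the block states of the Haar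
encryption. The `G_t` can be chosen measurable in `k`.

An attack on the Haar encryption yields, for each unitary `U` and each `t`, an attack on `Q`: embed
by `U V` and use the key `U G_t(k)⁻¹`. By right invariance of the Haar measure, the average of their
values over `U` and `t` is the value of the original attack.
-/

namespace QEnc

section Selection

variable {X Y : Type*} [TopologicalSpace X] [MeasurableSpace X] [OpensMeasurableSpace X]
  [TopologicalSpace Y]

theorem measurableSet_image_fst_of_isClosed [CompactSpace Y] {R : Set (X × Y)} (hR : IsClosed R) :
    MeasurableSet (Prod.fst '' R) :=
  (isClosedMap_fst_of_compactSpace R hR).measurableSet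

theorem exists_measurable_isLeast {K : Set ℝ} (hK : IsCompact K) {R : Set (X × K)}
    (hR : IsClosed R) (hne : ∀ x, ∃ t, (x, t) ∈ R) :
    ∃ T : X → K, Measurable T ∧ ∀ x, IsLeast {t | (x, t) ∈ R} (T x) := by
  have := isCompact_iff_compactSpace.mp hK
  have hfibre (x : X) : IsClosed {t | (x, t) ∈ R} := hR.preimage (by fun_prop)
  choose T hT using fun x => (hfibre x).isCompact.exists_isLeast (hne x)
  refine ⟨T, (MeasurableEmbedding.subtype_coe hK.measurableSet).measurable_comp_iff.mp <|
    measurable_of_Iic fun a => ?_, hT⟩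
  have hIic : Subtype.val ∘ T ⁻¹' Set.Iic a = Prod.fst '' (R ∩ {p | (p.2 : ℝ) ≤ a}) := by
    ext x
    constructor
    · exact fun hx => ⟨(x, T x), ⟨(hT x).1, hx⟩, rfl⟩
    · rintro ⟨⟨x, t⟩, ⟨ht, hta⟩, rfl⟩
      exact (Subtype.coe_le_coe.mpr ((hT x).2 ht)).trans hta
  rw [hIic]
  exact measurableSet_image_fst_of_isClosed (hR.inter (isClosed_le (by fun_prop) (by fun_prop)))

-- `Y` is a continuous image of the Cantor set, and in a compact subset of `ℝ` the least point of
-- the fibre of a closed relation is a measurable choice.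
theorem exists_measurable_selection_of_isClosed [CompactSpace Y]
    [TopologicalSpace.MetrizableSpace Y] [MeasurableSpace Y] [BorelSpace Y] [Nonempty Y]
    {R : Set (X × Y)} (hR : IsClosed R) :
    ∃ S : X → Y, Measurable S ∧ ∀ x, (∃ y, (x, y) ∈ R) → (x, S x) ∈ R := by
  let := TopologicalSpace.metrizableSpaceMetric Y
  obtain ⟨f, hf, hf_surj⟩ := exists_nat_bool_continuous_surjective_of_compact Y
  let c : cantorSet → Y := f ∘ cantorSetHomeomorphNatToBool
  have hc : Continuous c := hf.comp cantorSetHomeomorphNatToBool.continuous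
  have hc_surj : c.Surjective := hf_surj.comp cantorSetHomeomorphNatToBool.surjective
  let D : Set X := Prod.fst '' R
  have hD : MeasurableSet D := measurableSet_image_fst_of_isClosed hR
  let R' : Set (D × cantorSet) := (Prod.map Subtype.val c) ⁻¹' R
  have hR' : IsClosed R' := hR.preimage (continuous_subtype_val.prodMap hc)
  have hR'_ne (x : D) : ∃ t, (x, t) ∈ R' := by
    obtain ⟨_, ⟨x, y⟩, hxy, rfl⟩ := x
    obtain ⟨t, rfl⟩ := hc_surj y
    exact ⟨t, hxy⟩
  obtain ⟨T, hT, hT_least⟩ := exists_measurable_isLeast isCompact_cantorSet hR' hR'_ne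
  obtain ⟨S, hS, hS_eq⟩ := (MeasurableEmbedding.subtype_coe hD).exists_measurable_extend
    (hc.measurable.comp hT) fun _ => inferInstance
  refine ⟨S, hS, fun x ⟨y, hxy⟩ => ?_⟩
  have hx : x ∈ D := ⟨(x, y), hxy, rfl⟩
  rw [show S x = c (T ⟨x, hx⟩) from congrFun hS_eq ⟨x, hx⟩]
  exact (hT_least ⟨x, hx⟩).1

end Selection

section PosSemidef

variable {n 𝕜 : Type*} [Fintype n] [RCLike 𝕜]

open scoped MatrixOrder in
theorem exists_eq_conjTranspose_mul_self_of_posSemidef {X : Matrix n n 𝕜} (hX : X.PosSemidef) :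
    ∃ C : Matrix n n 𝕜, X = Cᴴ * C := by
  classical
  exact CStarAlgebra.nonneg_iff_eq_star_mul_self.mp hX.nonneg

theorem trace_mul_nonneg_of_posSemidef {X Y : Matrix n n 𝕜} (hX : X.PosSemidef)
    (hY : Y.PosSemidef) : 0 ≤ (X * Y).trace := by
  obtain ⟨C, rfl⟩ := exists_eq_conjTranspose_mul_self_of_posSemidef hX
  rw [Matrix.mul_assoc, Matrix.trace_mul_comm]
  exact (hY.mul_mul_conjTranspose_same C).trace_nonneg

theorem mul_eq_zero_of_trace_mul_eq_zero {X Y : Matrix n n 𝕜} (hX : X.PosSemidef)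
    (hY : Y.PosSemidef) (h : (X * Y).trace = 0) : X * Y = 0 := by
  obtain ⟨C, rfl⟩ := exists_eq_conjTranspose_mul_self_of_posSemidef hX
  obtain ⟨D, rfl⟩ := exists_eq_conjTranspose_mul_self_of_posSemidef hY
  have hCD : C * Dᴴ = 0 := by
    rw [← trace_mul_conjTranspose_self_eq_zero_iff, ← h, conjTranspose_mul,
      conjTranspose_conjTranspose, Matrix.mul_assoc Cᴴ, Matrix.trace_mul_comm Cᴴ]
    simp only [Matrix.mul_assoc]
  rw [Matrix.mul_assoc, ← Matrix.mul_assoc C, hCD, Matrix.zero_mul, Matrix.mul_zero]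

end PosSemidef

section POVM

variable {ι : Type*} [Fintype ι] {B : Type} [Fintype B] [DecidableEq B] {P : ι → Matrix B B ℂ}

theorem IsPOVM.sum_trace_mul (hP : IsPOVM P) (ρ : Matrix B B ℂ) :
    ∑ m, (P m * ρ).trace = ρ.trace := by
  rw [← Matrix.trace_sum, ← Finset.sum_mul, hP.2, Matrix.one_mul]

theorem IsPOVM.trace_mul_nonneg (hP : IsPOVM P) {ρ : Matrix B B ℂ} (hρ : IsState ρ) (m : ι) :
    0 ≤ (P m * ρ).trace :=
  trace_mul_nonneg_of_posSemidef (hP.1 m) hρ.1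

theorem IsPOVM.trace_mul_re_mem_Icc (hP : IsPOVM P) {ρ : Matrix B B ℂ} (hρ : IsState ρ) (m : ι) :
    (P m * ρ).trace.re ∈ Set.Icc 0 1 := by
  have hle : (P m * ρ).trace ≤ 1 := by
    rw [← hρ.2, ← hP.sum_trace_mul ρ]
    exact Finset.single_le_sum (fun j _ => hP.trace_mul_nonneg hρ j) (Finset.mem_univ m)
  exact ⟨(Complex.le_def.mp (hP.trace_mul_nonneg hρ m)).1, (Complex.le_def.mp hle).1⟩

theorem IsPOVM.mul_eq_zero_of_trace_re_eq_one (hP : IsPOVM P) {ρ : Matrix B B ℂ}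
    (hρ : IsState ρ) {m j : ι} (h : (P m * ρ).trace.re = 1) (hj : j ≠ m) : P j * ρ = 0 := by
  classical
  have hm : (P m * ρ).trace = ρ.trace := by
    rw [hρ.2]
    exact Complex.ext h (Complex.le_def.mp (hP.trace_mul_nonneg hρ m)).2.symm
  have hsum : ∑ i ∈ Finset.univ.erase m, (P i * ρ).trace = 0 := by
    have h_all := hP.sum_trace_mul ρ
    rwa [← Finset.add_sum_erase _ _ (Finset.mem_univ m), hm, add_eq_left] at h_all
  refine mul_eq_zero_of_trace_mul_eq_zero (hP.1 j) hρ.1 ?_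
  exact (Finset.sum_eq_zero_iff_of_nonneg fun i _ => hP.trace_mul_nonneg hρ i).mp hsum j
    (Finset.mem_erase.mpr ⟨hj, Finset.mem_univ j⟩)

theorem IsPOVM.mul_eq_self_of_trace_re_eq_one (hP : IsPOVM P) {ρ : Matrix B B ℂ}
    (hρ : IsState ρ) {m : ι} (h : (P m * ρ).trace.re = 1) : P m * ρ = ρ := by
  calc P m * ρ = ∑ j, P j * ρ :=
        (Finset.sum_eq_single m (fun j _ hj => hP.mul_eq_zero_of_trace_re_eq_one hρ h hj)
          (by simp)).symm
    _ = ρ := by rw [← Finset.sum_mul, hP.2, Matrix.one_mul]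

theorem IsPOVM.state_mul_state_eq_zero (hP : IsPOVM P) {ρ : ι → Matrix B B ℂ}
    (hρ : ∀ m, IsState (ρ m)) (h : ∀ m, (P m * ρ m).trace.re = 1) {m m' : ι} (hm : m ≠ m') :
    ρ m * ρ m' = 0 := by
  have hfix : ρ m * P m = ρ m := by
    simpa [(hP.1 m).isHermitian.eq, (hρ m).1.isHermitian.eq] using
      congrArg conjTranspose (hP.mul_eq_self_of_trace_re_eq_one (hρ m) (h m))
  rw [← hfix, Matrix.mul_assoc, hP.mul_eq_zero_of_trace_re_eq_one (hρ m') (h m') hm,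
    Matrix.mul_zero]

end POVM

section Tensor

variable {s : ℕ} {B : Fin s → Type}

theorem tensor_mul [∀ i, Fintype (B i)] (P R : ∀ i, Matrix (B i) (B i) ℂ) :
    tensor (fun i => P i * R i) = tensor P * tensor R := by
  ext x y
  simp only [tensor, Matrix.of_apply, Matrix.mul_apply, Finset.prod_univ_sum,
    Fintype.piFinset_univ, Finset.prod_mul_distrib]

theorem tensor_conjTranspose (P : ∀ i, Matrix (B i) (B i) ℂ) :
    tensor (fun i => (P i)ᴴ) = (tensor P)ᴴ := by
  ext x y
  simp [tensor]

theorem tensor_one [∀ i, DecidableEq (B i)] :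
    tensor (fun i => (1 : Matrix (B i) (B i) ℂ)) = 1 := by
  ext x y
  simp [tensor, Matrix.one_apply, Fintype.prod_ite_zero, funext_iff]

theorem tensor_sum {ι : Type*} [Fintype ι] (P : ∀ i, ι → Matrix (B i) (B i) ℂ) :
    tensor (fun i => ∑ m, P i m) = ∑ f : Fin s → ι, tensor (fun i => P i (f i)) := by
  ext x y
  simp only [tensor, Matrix.of_apply, Matrix.sum_apply, Finset.prod_univ_sum,
    Fintype.piFinset_univ]

theorem tensor_posSemidef [∀ i, Finite (B i)] {P : ∀ i, Matrix (B i) (B i) ℂ}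
    (hP : ∀ i, (P i).PosSemidef) : (tensor P).PosSemidef := by
  have (i : Fin s) : Fintype (B i) := Fintype.ofFinite _
  choose C hC using fun i => exists_eq_conjTranspose_mul_self_of_posSemidef (hP i)
  rw [funext hC, tensor_mul, tensor_conjTranspose]
  exact posSemidef_conjTranspose_mul_self _

theorem IsPOVM.tensor [∀ i, Fintype (B i)] [∀ i, DecidableEq (B i)] {ι : Type*} [Fintype ι]
    {P : ∀ i, ι → Matrix (B i) (B i) ℂ} (hP : ∀ i, IsPOVM (P i)) :
    IsPOVM fun f : Fin s → ι => QEnc.tensor fun i => P i (f i) :=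
  ⟨fun f => tensor_posSemidef fun i => (hP i).1 (f i), by
    rw [← tensor_sum, funext fun i => (hP i).2, tensor_one]⟩

end Tensor

section Conj

variable {A A' A'' : Type} [Fintype A]

theorem conj_apply (V : Matrix A' A ℂ) (X : Matrix A A ℂ) : conj V X = V * X * Vᴴ := rfl

theorem conj_mul_apply [Fintype A'] (V : Matrix A'' A' ℂ) (W : Matrix A' A ℂ)
    (X : Matrix A A ℂ) : conj (V * W) X = conj V (conj W X) := by
  simp only [conj_apply, conjTranspose_mul, Matrix.mul_assoc]

theorem conj_mul_conj [DecidableEq A] [Fintype A'] {V : Matrix A' A ℂ} (hV : Vᴴ * V = 1)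
    (X Y : Matrix A A ℂ) : conj V X * conj V Y = conj V (X * Y) := by
  calc V * X * Vᴴ * (V * Y * Vᴴ) = V * (X * (Vᴴ * V) * Y) * Vᴴ := by simp only [Matrix.mul_assoc]
    _ = V * (X * Y) * Vᴴ := by rw [hV, Matrix.mul_one]

theorem rank_conj_le [Fintype A'] (V : Matrix A' A ℂ) (X : Matrix A A ℂ) :
    (conj V X).rank ≤ X.rank :=
  (rank_mul_le_left _ _).trans (rank_mul_le_right _ _)

theorem IsState.conj [DecidableEq A] [Fintype A'] {ρ : Matrix A A ℂ} (hρ : IsState ρ)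
    {V : Matrix A' A ℂ} (hV : Vᴴ * V = 1) : IsState (conj V ρ) := by
  refine ⟨hρ.1.mul_mul_conjTranspose_same V, ?_⟩
  rw [conj_apply, Matrix.trace_mul_comm, ← Matrix.mul_assoc, hV, Matrix.one_mul, hρ.2]

theorem exists_isometry [DecidableEq A] [Fintype A']
    (h : Fintype.card A ≤ Fintype.card A') : ∃ V : Matrix A' A ℂ, Vᴴ * V = 1 := by
  classical
  obtain ⟨f⟩ := Function.Embedding.nonempty_of_card_le h
  refine ⟨(1 : Matrix A' A' ℂ).submatrix id f, ?_⟩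
  rw [conjTranspose_submatrix, conjTranspose_one, ← submatrix_mul _ _ _ _ _ Function.bijective_id,
    Matrix.mul_one, submatrix_one_embedding]

end Conj

section Measurability

variable {Z : Type*} [MeasurableSpace Z]

theorem measurable_linearMap_matrix_apply {m n : Type*} [Finite m] [Finite n] {E : Type*}
    [NormedAddCommGroup E] [NormedSpace ℂ E] [MeasurableSpace E] [BorelSpace E]
    (L : Matrix m n ℂ →ₗ[ℂ] E) {X : Z → Matrix m n ℂ}
    (hX : ∀ i j, Measurable fun z => X z i j) : Measurable fun z => L (X z) := by
  have hL := (L ∘ₗ (Matrix.ofLinearEquiv ℂ).toLinearMap).continuous_of_finiteDimensional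
  exact hL.measurable.comp <| measurable_pi_lambda _ fun i => measurable_pi_lambda _ fun j => hX i j

theorem measurable_conj_apply {A A' : Type} [Fintype A] {V : Z → Matrix A' A ℂ}
    {X : Z → Matrix A A ℂ} (hV : ∀ i j, Measurable fun z => V z i j)
    (hX : ∀ i j, Measurable fun z => X z i j) (i j : A') :
    Measurable fun z => conj (V z) (X z) i j := by
  simp only [conj_apply, Matrix.mul_apply, Matrix.conjTranspose_apply]
  fun_prop

end Measurability

section Channel

variable {A B : Type} [Fintype A] [Fintype B]

theorem Channel.posSemidef (Φ : Channel A B) {ρ : Matrix A A ℂ} (hρ : ρ.PosSemidef) :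
    (Φ.toLin ρ).PosSemidef :=
  (Φ.completelyPositive 1 (ρ.submatrix Prod.fst Prod.fst) (hρ.submatrix _)).submatrix
    fun b => (b, 0)

theorem Channel.isState (Φ : Channel A B) {ρ : Matrix A A ℂ} (hρ : IsState ρ) :
    IsState (Φ.toLin ρ) :=
  ⟨Φ.posSemidef hρ.1, (Φ.tracePreserving ρ).trans hρ.2⟩

end Channel

section Score

variable {M K : Type*} [MeasurableSpace K] {A : Type} [Fintype A] {F : ChannelClass} {N s : ℕ}

/-- The success probability of an attack on the ensemble of ciphertexts `ρ` when the receivers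
measure according to the key `k`. The key and the ensemble vary independently. -/
noncomputable def Attack.score (𝒜 : Attack M K A F N s) (k : K) (ρ : M → Matrix A A ℂ) : ℝ :=
  letI := 𝒜.fintypeB
  (1 / (N : ℝ)) * ∑ m : 𝒜.M₀, (tensor (fun i => 𝒜.P i k m) * 𝒜.Φ.toLin (ρ m)).trace.re

theorem QECM.attackValue_eq_integral_score (Q : QECM M K A) (𝒜 : Attack M K A F N s) :
    Q.attackValue 𝒜 = ∫ k, 𝒜.score k (Q.cipher k) ∂Q.keyDist := rfl

theorem Attack.score_sum (𝒜 : Attack M K A F N s) (k : K) {ι : Type*} [Fintype ι]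
    (ρ : ι → M → Matrix A A ℂ) : 𝒜.score k (∑ t, ρ t) = ∑ t, 𝒜.score k (ρ t) := by
  simp only [Attack.score, Finset.sum_apply, map_sum, Matrix.mul_sum, Finset.mul_sum,
    Matrix.trace_sum, Complex.re_sum]
  exact Finset.sum_comm

theorem Attack.score_smul (𝒜 : Attack M K A F N s) (k : K) (c : ℝ) (ρ : M → Matrix A A ℂ) :
    𝒜.score k (c • ρ) = c * 𝒜.score k ρ := by
  simp only [Attack.score, Pi.smul_apply, LinearMap.map_smul_of_tower, Matrix.mul_smul,
    Matrix.trace_smul, Complex.smul_re, smul_eq_mul, ← Finset.mul_sum]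
  ring

theorem Attack.score_mem_Icc (𝒜 : Attack M K A F N s) (k : K) {ρ : M → Matrix A A ℂ}
    (hρ : ∀ m, IsState (ρ m)) : 𝒜.score k ρ ∈ Set.Icc 0 1 := by
  let := 𝒜.fintypeB
  let := 𝒜.decEqB
  have h (m : 𝒜.M₀) := (IsPOVM.tensor fun i => 𝒜.isPOVM i k).trace_mul_re_mem_Icc
    (𝒜.Φ.isState (hρ m)) fun _ => m
  have hle : ∑ m : 𝒜.M₀, (tensor (fun i => 𝒜.P i k m) * 𝒜.Φ.toLin (ρ m)).trace.re ≤ N := by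
    refine (Finset.sum_le_sum fun m _ => (h m).2).trans ?_
    simp [𝒜.card_M₀]
  refine ⟨mul_nonneg (by positivity) (Finset.sum_nonneg fun m _ => (h m).1), ?_⟩
  calc 𝒜.score k ρ ≤ 1 / (N : ℝ) * N := mul_le_mul_of_nonneg_left hle (by positivity)
    _ ≤ 1 := by rw [one_div]; exact inv_mul_le_one

theorem Attack.norm_score_le_one (𝒜 : Attack M K A F N s) (k : K) {ρ : M → Matrix A A ℂ}
    (hρ : ∀ m, IsState (ρ m)) : ‖𝒜.score k ρ‖ ≤ 1 := by
  obtain ⟨h₀, h₁⟩ := 𝒜.score_mem_Icc k hρ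
  rwa [Real.norm_of_nonneg h₀]

theorem Attack.measurable_score (𝒜 : Attack M K A F N s) {Z : Type*} [MeasurableSpace Z]
    {g : Z → K} (hg : Measurable g) {ρ : Z → M → Matrix A A ℂ}
    (hρ : ∀ m a a', Measurable fun z => ρ z m a a') :
    Measurable fun z => 𝒜.score (g z) (ρ z) := by
  let := 𝒜.fintypeB
  have hP (i) (m : 𝒜.M₀) (b b') : Measurable fun z => 𝒜.P i (g z) m b b' :=
    (𝒜.measurable_P i m b b').comp hg
  have hΦ (m : M) (x y) : Measurable fun z => 𝒜.Φ.toLin (ρ z m) x y :=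
    measurable_linearMap_matrix_apply (Matrix.entryLinearMap ℂ ℂ x y ∘ₗ 𝒜.Φ.toLin) (hρ m)
  simp only [Attack.score, Matrix.trace, Matrix.diag, Matrix.mul_apply, tensor, Matrix.of_apply]
  fun_prop

theorem Attack.integrable_score (𝒜 : Attack M K A F N s) {Z : Type*} [MeasurableSpace Z]
    {μ : Measure Z} [IsFiniteMeasure μ] {g : Z → K} (hg : Measurable g)
    {ρ : Z → M → Matrix A A ℂ} (hρ : ∀ m a a', Measurable fun z => ρ z m a a')
    (hstate : ∀ z m, IsState (ρ z m)) : Integrable (fun z => 𝒜.score (g z) (ρ z)) μ :=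
  .of_bound (𝒜.measurable_score hg hρ).aestronglyMeasurable 1
    (.of_forall fun z => 𝒜.norm_score_le_one (g z) (hstate z))

theorem QECM.attackValue_mem_Icc (Q : QECM M K A) (𝒜 : Attack M K A F N s) :
    Q.attackValue 𝒜 ∈ Set.Icc 0 1 := by
  have := Q.isProb
  have h (k : K) := 𝒜.score_mem_Icc k (Q.isState k)
  have hint := 𝒜.integrable_score (μ := Q.keyDist) measurable_id Q.measurable_cipher Q.isState
  refine ⟨integral_nonneg fun k => (h k).1, ?_⟩
  simpa [attackValue_eq_integral_score] using
    integral_mono hint (integrable_const 1) fun k => (h k).2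

theorem QECM.cloningValue_nonneg (Q : QECM M K A) : 0 ≤ Q.cloningValue F N s :=
  Real.iSup_nonneg fun 𝒜 => (Q.attackValue_mem_Icc 𝒜).1

theorem QECM.attackValue_le_cloningValue (Q : QECM M K A) (𝒜 : Attack M K A F N s) :
    Q.attackValue 𝒜 ≤ Q.cloningValue F N s :=
  le_ciSup ⟨1, Set.forall_mem_range.mpr fun ℬ => (Q.attackValue_mem_Icc ℬ).2⟩ 𝒜

theorem QECM.cloningValue_of_isEmpty [IsEmpty M] (Q : QECM M K A) : Q.cloningValue F N s = 0 := by
  simp [cloningValue, attackValue]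

end Score

section OrthogonalHermitian

variable {𝕜 ι M : Type*} [RCLike 𝕜] [Fintype ι] [DecidableEq ι]

theorem toEuclideanLin_eigenvectorBasis {τ : Matrix ι ι 𝕜} (hτ : τ.IsHermitian) (a : ι) :
    toEuclideanLin τ (hτ.eigenvectorBasis a) =
      (hτ.eigenvalues a : 𝕜) • hτ.eigenvectorBasis a := by
  ext i
  simpa [RCLike.real_smul_eq_coe_mul] using congrFun (hτ.mulVec_eigenvectorBasis a) i

theorem toEuclideanLin_eq_zero_of_inner_eigenvectorBasis_eq_zero {τ : Matrix ι ι 𝕜}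
    (hτ : τ.IsHermitian) {x : EuclideanSpace 𝕜 ι}
    (hx : ∀ a, hτ.eigenvalues a ≠ 0 → inner 𝕜 (hτ.eigenvectorBasis a) x = 0) :
    toEuclideanLin τ x = 0 := by
  refine InnerProductSpace.ext_inner_left_basis hτ.eigenvectorBasis.toBasis fun a => ?_
  rw [OrthonormalBasis.coe_toBasis, inner_zero_right,
    ← isSymmetric_toEuclideanLin_iff.mpr hτ, toEuclideanLin_eigenvectorBasis, inner_smul_left]
  by_cases ha : hτ.eigenvalues a = 0
  · simp [ha]
  · rw [hx a ha, mul_zero]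

theorem inner_eigenvectorBasis_eq_zero_of_mul_eq_zero {τ σ : Matrix ι ι 𝕜} (hτ : τ.IsHermitian)
    (hσ : σ.IsHermitian) (hτσ : τ * σ = 0) {a b : ι} (ha : hτ.eigenvalues a ≠ 0)
    (hb : hσ.eigenvalues b ≠ 0) :
    inner 𝕜 (hτ.eigenvectorBasis a) (hσ.eigenvectorBasis b) = 0 := by
  have h : inner 𝕜 (toEuclideanLin τ (hτ.eigenvectorBasis a))
      (toEuclideanLin σ (hσ.eigenvectorBasis b)) = 0 := by
    have hzero : toEuclideanLin τ (toEuclideanLin σ (hσ.eigenvectorBasis b)) = 0 := by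
      ext i
      simp [hτσ]
    rw [isSymmetric_toEuclideanLin_iff.mpr hτ, hzero, inner_zero_right]
  rw [toEuclideanLin_eigenvectorBasis, toEuclideanLin_eigenvectorBasis, inner_smul_left,
    inner_smul_right] at h
  simpa [ha, hb] using h

theorem orthonormal_sigma_eigenvectorBasis {τ : M → Matrix ι ι 𝕜}
    (hτ : ∀ m, (τ m).IsHermitian) (horth : Pairwise fun m m' => τ m * τ m' = 0) :
    Orthonormal 𝕜 fun p : Σ m, {a // (hτ m).eigenvalues a ≠ 0} =>
      (hτ p.1).eigenvectorBasis p.2 := by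
  classical
  rw [orthonormal_iff_ite]
  rintro ⟨m, a, ha⟩ ⟨m', a', ha'⟩
  by_cases hm : m = m'
  · subst hm
    rw [orthonormal_iff_ite.mp (hτ m).eigenvectorBasis.orthonormal]
    simp
  · rw [if_neg (by simp [hm])]
    exact inner_eigenvectorBasis_eq_zero_of_mul_eq_zero (hτ m) (hτ m') (horth hm) ha ha'

theorem sum_rank_le_card [Fintype M] {n : Type*} [Fintype n] {τ : M → Matrix n n 𝕜}
    (hτ : ∀ m, (τ m).IsHermitian) (horth : Pairwise fun m m' => τ m * τ m' = 0) :
    ∑ m, (τ m).rank ≤ Fintype.card n := by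
  classical
  have h := (orthonormal_sigma_eigenvectorBasis hτ horth).linearIndependent
    |>.fintype_card_le_finrank
  rw [finrank_euclideanSpace, Fintype.card_sigma] at h
  simpa only [(hτ _).rank_eq_card_non_zero_eigs] using h

theorem exists_orthonormalBasis_comp_eq {E I J : Type*} [NormedAddCommGroup E]
    [InnerProductSpace 𝕜 E] [FiniteDimensional 𝕜 E] [Fintype I]
    (hI : Module.finrank 𝕜 E = Fintype.card I) {w : J → E} (hw : Orthonormal 𝕜 w) {g : J → I}
    (hg : g.Injective) : ∃ b : OrthonormalBasis I 𝕜 E, ∀ j, b (g j) = w j := by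
  have hw' : Orthonormal 𝕜 ((Set.range g).domRestrict (Function.extend g w 0)) := by
    convert hw.comp (Equiv.ofInjective g hg).symm (Equiv.injective _) using 1
    funext x
    obtain ⟨j, rfl⟩ := (Equiv.ofInjective g hg).surjective x
    simp [hg.extend_apply]
  obtain ⟨b, hb⟩ := hw'.exists_orthonormalBasis_extension_of_card_eq hI
  exact ⟨b, fun j => (hb _ ⟨j, rfl⟩).trans (hg.extend_apply _ _ j)⟩

theorem exists_orthonormalBasis_prod_eigenvector {κ : Type*} [Fintype M] [Fintype κ]
    (hcard : Fintype.card (M × κ) = Fintype.card ι) {τ : M → Matrix ι ι 𝕜}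
    (hτ : ∀ m, (τ m).IsHermitian) (horth : Pairwise fun m m' => τ m * τ m' = 0)
    (hrank : ∀ m, (τ m).rank ≤ Fintype.card κ) :
    ∃ b : OrthonormalBasis (M × κ) 𝕜 (EuclideanSpace 𝕜 ι), ∀ m j, ∃ c : 𝕜,
      toEuclideanLin (τ m) (b j) = c • b j ∧ (j.1 ≠ m → c = 0) := by
  have hemb (m : M) : Nonempty ({a // (hτ m).eigenvalues a ≠ 0} ↪ κ) := by
    refine Function.Embedding.nonempty_of_card_le ?_
    rw [← (hτ m).rank_eq_card_non_zero_eigs]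
    exact hrank m
  let g : (Σ m, {a // (hτ m).eigenvalues a ≠ 0}) → M × κ := fun p => (p.1, (hemb p.1).some p.2)
  have hg : g.Injective := by
    rintro ⟨m, a⟩ ⟨m', a'⟩ h
    simp only [g, Prod.mk.injEq] at h
    obtain ⟨rfl, h⟩ := h
    obtain rfl := (hemb m).some.injective h
    rfl
  have hfinrank : Module.finrank 𝕜 (EuclideanSpace 𝕜 ι) = Fintype.card (M × κ) :=
    finrank_euclideanSpace.trans hcard.symm
  obtain ⟨b, hb⟩ := exists_orthonormalBasis_comp_eq hfinrank
    (orthonormal_sigma_eigenvectorBasis hτ horth) hg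
  refine ⟨b, fun m j => ?_⟩
  by_cases hj : ∃ a, g ⟨m, a⟩ = j
  · obtain ⟨a, rfl⟩ := hj
    refine ⟨((hτ m).eigenvalues a : 𝕜), ?_, fun h => absurd rfl h⟩
    rw [hb]
    exact toEuclideanLin_eigenvectorBasis (hτ m) a
  · refine ⟨0, ?_, fun _ => rfl⟩
    rw [zero_smul]
    refine toEuclideanLin_eq_zero_of_inner_eigenvectorBasis_eq_zero (hτ m) fun a ha => ?_
    rw [← hb ⟨m, a, ha⟩]
    have hne : g ⟨m, a, ha⟩ ≠ j := fun h => hj ⟨_, h⟩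
    exact b.orthonormal.2 hne

end OrthogonalHermitian

section MixingUnitaries

variable {ι : Type} [Fintype ι] [DecidableEq ι]

/-- The unitary sending the orthonormal basis `b` to the standard basis; its rows are the conjugates
of the vectors `b i`. -/
noncomputable def basisUnitary (b : OrthonormalBasis ι ℂ (EuclideanSpace ℂ ι)) :
    unitaryGroup ι ℂ :=
  ⟨b.toBasis.toMatrix (EuclideanSpace.basisFun ι ℂ).toBasis,
    b.toMatrix_orthonormalBasis_mem_unitary (EuclideanSpace.basisFun ι ℂ)⟩

theorem conj_basisUnitary_apply (b : OrthonormalBasis ι ℂ (EuclideanSpace ℂ ι))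
    (X : Matrix ι ι ℂ) (i j : ι) :
    conj (basisUnitary b).1 X i j = inner ℂ (b i) (toEuclideanLin X (b j)) := by
  have hW (i k : ι) : (basisUnitary b).1 i k = star (b i k) := by
    simp [basisUnitary, Module.Basis.toMatrix_apply, OrthonormalBasis.repr_apply_apply,
      EuclideanSpace.inner_single_right]
  rw [conj_apply, Matrix.mul_assoc]
  simp only [Matrix.mul_apply, hW, EuclideanSpace.inner_eq_star_dotProduct, dotProduct,
    conjTranspose_apply, star_star, toLpLin_apply, mulVec, Pi.star_apply]
  exact Finset.sum_congr rfl fun k _ => mul_comm _ _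

theorem trace_eq_sum_inner_toEuclideanLin {I : Type*} [Fintype I]
    (b : OrthonormalBasis I ℂ (EuclideanSpace ℂ ι)) (X : Matrix ι ι ℂ) :
    X.trace = ∑ i, inner ℂ (b i) (toEuclideanLin X (b i)) := by
  rw [← LinearMap.trace_eq_sum_inner,
    LinearMap.trace_eq_sum_inner _ (EuclideanSpace.basisFun ι ℂ)]
  simp [trace, EuclideanSpace.inner_single_left]

theorem exists_unitary_sum_conj_eq_diagonal {M κ : Type*} [Finite M] [DecidableEq M] [Fintype κ]
    [AddGroup κ] (e : M × κ ≃ ι) {τ : M → Matrix ι ι ℂ} (hτ : ∀ m, (τ m).IsHermitian)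
    (horth : Pairwise fun m m' => τ m * τ m' = 0) (hrank : ∀ m, (τ m).rank ≤ Fintype.card κ) :
    ∃ G : κ → unitaryGroup ι ℂ, ∀ m, ∑ t, conj (G t).1 (τ m) =
      diagonal fun i => if (e.symm i).1 = m then (τ m).trace else 0 := by
  have := Fintype.ofFinite M
  obtain ⟨b, hb⟩ :=
    exists_orthonormalBasis_prod_eigenvector (Fintype.card_congr e) hτ horth hrank
  classical
  choose c hc hc_zero using hb
  -- Shifting each block by every `t` puts all the eigenvalues of `τ m` in turn at each position of
  -- block `m`, where they add up to the trace.
  let shift (t : κ) : M × κ ≃ ι := ((Equiv.refl M).prodCongr (Equiv.addRight t)).symm.trans e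
  have hinner (m : M) (j j' : M × κ) :
      inner ℂ (b j) (toEuclideanLin (τ m) (b j')) = if j = j' then c m j else 0 := by
    rw [hc, inner_smul_right, orthonormal_iff_ite.mp b.orthonormal, mul_ite, mul_one, mul_zero]
    exact ite_congr rfl (fun h => by rw [h]) fun _ => rfl
  have htrace (m : M) : (τ m).trace = ∑ u, c m (m, u) := by
    simp only [trace_eq_sum_inner_toEuclideanLin b, hinner, if_true]
    rw [Fintype.sum_prod_type, Fintype.sum_eq_single m fun m' hm =>
      Finset.sum_eq_zero fun u _ => hc_zero m (m', u) hm]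
  have hshift (t : κ) (m : M) (u : κ) : (shift t).symm (e (m, u)) = (m, u + t) := by
    simp [shift]
  refine ⟨fun t => basisUnitary (b.reindex (shift t)), fun m => ?_⟩
  ext i j
  simp only [Matrix.sum_apply, conj_basisUnitary_apply, OrthonormalBasis.reindex_apply, hinner,
    diagonal_apply, EmbeddingLike.apply_eq_iff_eq]
  obtain rfl | hij := eq_or_ne i j
  · obtain ⟨⟨m', u⟩, rfl⟩ := e.surjective i
    simp only [if_true, hshift, Equiv.symm_apply_apply]
    by_cases hm : m' = m
    · subst hm
      rw [if_pos rfl, htrace]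
      exact Equiv.sum_comp (Equiv.addLeft u) fun v => c m' (m', v)
    · simp [hm, hc_zero]
  · simp [hij]

end MixingUnitaries

section Blocks

variable {r n : ℕ}

/-- The position `r i + t` of the `t`-th basis vector of the `i`-th block of `ℂ^(r n)`. -/
def blockEquiv (r n : ℕ) : Fin n × Fin r ≃ Fin (r * n) :=
  finProdFinEquiv.trans (finCongr (Nat.mul_comm n r))

theorem blockState_eq (i : Fin n) :
    blockState r n i =
      diagonal fun j => if ((blockEquiv r n).symm j).1 = i then (r : ℂ)⁻¹ else 0 := by
  refine congrArg diagonal (funext fun j => if_congr ?_ rfl rfl)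
  have hr : 0 < r := Nat.pos_of_mul_pos_right (Fin.pos j)
  have hdiv : ((blockEquiv r n).symm j).1.val = j.val / r := rfl
  rw [Fin.ext_iff, hdiv, Nat.div_eq_iff hr, Nat.mul_comm i.val, Nat.mul_succ]
  omega

theorem exists_unitary_sum_conj_eq_smul_blockState [NeZero r]
    {τ : Fin n → Matrix (Fin (r * n)) (Fin (r * n)) ℂ} (hτ : ∀ i, IsState (τ i))
    (horth : Pairwise fun i j => τ i * τ j = 0) (hrank : ∀ i, (τ i).rank ≤ r) :
    ∃ G : Fin r → unitaryGroup (Fin (r * n)) ℂ, ∀ i,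
      ∑ t, conj (G t).1 (τ i) = (r : ℝ) • blockState r n i := by
  obtain ⟨G, hG⟩ := exists_unitary_sum_conj_eq_diagonal (blockEquiv r n)
    (fun i => (hτ i).1.isHermitian) horth fun i => (hrank i).trans_eq (Fintype.card_fin r).symm
  refine ⟨G, fun i => ?_⟩
  rw [hG, blockState_eq, ← diagonal_smul]
  refine congrArg diagonal (funext fun j => ?_)
  simp [(hτ i).2, NeZero.ne r]

end Blocks

section Correct

variable {M : Type*} [Fintype M] {A : Type} [Fintype A]

theorem IsState.rank_pos {ρ : Matrix A A ℂ} (hρ : IsState ρ) : 0 < ρ.rank := by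
  refine Nat.pos_of_ne_zero fun hrank => ?_
  rw [rank, Submodule.finrank_eq_zero, LinearMap.range_eq_bot] at hrank
  classical
  obtain rfl : ρ = 0 := toLin'.map_eq_zero_iff.mp hrank
  simpa using hρ.2

theorem card_add_rank_le_of_pairwise_mul_eq_zero {ρ : M → Matrix A A ℂ} (hρ : ∀ m, IsState (ρ m))
    (horth : Pairwise fun m m' => ρ m * ρ m' = 0) (m : M) :
    Fintype.card M + (ρ m).rank ≤ Fintype.card A + 1 := by
  classical
  have hsum := sum_rank_le_card (fun m => (hρ m).1.isHermitian) horth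
  have hothers : (Finset.univ.erase m).card • 1 ≤ ∑ j ∈ Finset.univ.erase m, (ρ j).rank :=
    Finset.card_nsmul_le_sum _ _ _ fun j _ => (hρ j).rank_pos
  rw [← Finset.add_sum_erase _ _ (Finset.mem_univ m)] at hsum
  rw [Finset.card_erase_of_mem (Finset.mem_univ m), Finset.card_univ, smul_eq_mul, mul_one]
    at hothers
  omega

theorem card_le_card_of_pairwise_mul_eq_zero {ρ : M → Matrix A A ℂ} (hρ : ∀ m, IsState (ρ m))
    (horth : Pairwise fun m m' => ρ m * ρ m' = 0) : Fintype.card M ≤ Fintype.card A := by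
  rcases isEmpty_or_nonempty M with hM | ⟨⟨m⟩⟩
  · simp
  · have := card_add_rank_le_of_pairwise_mul_eq_zero hρ horth m
    have := (hρ m).rank_pos
    omega

namespace QECM

variable [DecidableEq A] {K : Type*} [MeasurableSpace K] {Q : QECM M K A}

theorem IsCorrect.ae_trace_re_eq_one (hQ : Q.IsCorrect) :
    ∃ P : K → M → Matrix A A ℂ, (∀ k, IsPOVM (P k)) ∧
      ∀ᵐ k ∂Q.keyDist, ∀ m, (P k m * Q.cipher k m).trace.re = 1 := by
  have := Q.isProb
  obtain ⟨P, hP, hint⟩ := hQ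
  refine ⟨P, hP, ae_all_iff.mpr fun m => ?_⟩
  have hle_one (k : K) : (P k m * Q.cipher k m).trace.re ≤ 1 :=
    ((hP k).trace_mul_re_mem_Icc (Q.isState k m) m).2
  have hone_le : 1 ≤ ∫ k, (P k m * Q.cipher k m).trace.re ∂Q.keyDist := by
    simpa using hint m
  have hintegrable : Integrable (fun k => (P k m * Q.cipher k m).trace.re) Q.keyDist :=
    not_imp_comm.mp integral_undef (zero_lt_one.trans_le hone_le).ne'
  have hzero : ∫ k, (1 - (P k m * Q.cipher k m).trace.re) ∂Q.keyDist = 0 := by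
    refine le_antisymm ?_ (integral_nonneg fun k => sub_nonneg.mpr (hle_one k))
    rw [integral_sub (integrable_const _) hintegrable]
    simpa using hone_le
  filter_upwards [(integral_eq_zero_iff_of_nonneg (fun k => sub_nonneg.mpr (hle_one k))
    ((integrable_const _).sub hintegrable)).mp hzero] with k hk
  exact (sub_eq_zero.mp hk).symm

theorem IsCorrect.ae_orthogonal (hQ : Q.IsCorrect) :
    ∀ᵐ k ∂Q.keyDist, Pairwise fun m m' => Q.cipher k m * Q.cipher k m' = 0 := by
  obtain ⟨P, hP, hae⟩ := hQ.ae_trace_re_eq_one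
  filter_upwards [hae] with k hk m m' hm
  exact (hP k).state_mul_state_eq_zero (Q.isState k) hk hm

theorem IsCorrect.card_le (hQ : Q.IsCorrect) : Fintype.card M ≤ Fintype.card A := by
  have := Q.isProb
  obtain ⟨k, hk⟩ := hQ.ae_orthogonal.exists
  exact card_le_card_of_pairwise_mul_eq_zero (Q.isState k) hk

theorem IsCorrect.card_le_mul_card [Nonempty M] (hQ : Q.IsCorrect) :
    Fintype.card A ≤ (Fintype.card A - Fintype.card M + 1) * Fintype.card M := by
  have hle := hQ.card_le
  have := Nat.le_mul_of_pos_right (Fintype.card A - Fintype.card M) (Fintype.card_pos (α := M))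
  rw [Nat.succ_mul]
  omega

theorem IsCorrect.ae_rank_le (hQ : Q.IsCorrect) : ∀ᵐ k ∂Q.keyDist,
    ∀ m, (Q.cipher k m).rank ≤ Fintype.card A - Fintype.card M + 1 := by
  filter_upwards [hQ.ae_orthogonal] with k hk m
  have := card_add_rank_le_of_pairwise_mul_eq_zero (Q.isState k) hk m
  have := hQ.card_le
  omega

end QECM

end Correct

section Haar

instance haarUnitary_isHaarMeasure (d : ℕ) : (haarUnitary d).IsHaarMeasure :=
  inferInstanceAs (Measure.haarMeasure ⊤).IsHaarMeasure

instance haarUnitary_isMulRightInvariant (d : ℕ) : (haarUnitary d).IsMulRightInvariant where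
  map_mul_right_eq_self g := by
    have : IsProbabilityMeasure ((haarUnitary d).map (· * g)) :=
      Measure.isProbabilityMeasure_map (measurable_mul_const g).aemeasurable
    exact Measure.isHaarMeasure_eq_of_isProbabilityMeasure _ _

instance unitaryGroup_secondCountableTopology (d : ℕ) :
    SecondCountableTopology (unitaryGroup (Fin d) ℂ) :=
  have : SecondCountableTopology (Matrix (Fin d) (Fin d) ℂ) :=
    inferInstanceAs (SecondCountableTopology (Fin d → Fin d → ℂ))
  TopologicalSpace.Subtype.secondCountableTopology _

theorem measurable_unitary_apply {d : ℕ} (i j : Fin d) :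
    Measurable fun U : unitaryGroup (Fin d) ℂ => U.1 i j :=
  (continuous_subtype_val.matrix_elem i j).measurable

theorem exists_measurable_unitary_sum_conj_eq {d : ℕ} {ι κ : Type*} [Finite ι] [Fintype κ]
    {Z : Type*} [MeasurableSpace Z] {τ : Z → ι → Matrix (Fin d) (Fin d) ℂ}
    (hτ : ∀ i j j', Measurable fun z => τ z i j j') (σ : ι → Matrix (Fin d) (Fin d) ℂ) :
    ∃ G : Z → κ → unitaryGroup (Fin d) ℂ, (∀ t, Measurable fun z => G z t) ∧
      ∀ z, (∃ G' : κ → unitaryGroup (Fin d) ℂ, ∀ i, ∑ t, conj (G' t).1 (τ z i) = σ i) →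
        ∀ i, ∑ t, conj (G z t).1 (τ z i) = σ i := by
  let R : Set ((ι → Fin d → Fin d → ℂ) × (κ → unitaryGroup (Fin d) ℂ)) :=
    {p | ∀ i, ∑ t, conj (p.2 t).1 (Matrix.of (p.1 i)) = σ i}
  have hR : IsClosed R := by
    simp only [R, Set.ofPred_forall]
    refine isClosed_iInter fun i => isClosed_eq (continuous_finsetSum _ fun t _ => ?_)
      continuous_const
    have hU : Continuous fun p : (ι → Fin d → Fin d → ℂ) × (κ → unitaryGroup (Fin d) ℂ) =>
        (p.2 t).1 := by fun_prop
    have hX : Continuous fun p : (ι → Fin d → Fin d → ℂ) × (κ → unitaryGroup (Fin d) ℂ) =>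
        Matrix.of (p.1 i) := continuous_matrix fun a a' => by
      simp only [of_apply]
      fun_prop
    exact (hU.matrix_mul hX).matrix_mul hU.matrix_conjTranspose
  obtain ⟨S, hS, hS_mem⟩ := exists_measurable_selection_of_isClosed hR
  refine ⟨fun z => S fun i j j' => τ z i j j', fun t => (measurable_pi_apply t).comp (hS.comp ?_),
    fun z hz => hS_mem (fun i j j' => τ z i j j') hz⟩
  exact measurable_pi_lambda _ fun i => measurable_pi_lambda _ fun j =>
    measurable_pi_lambda _ fun j' => hτ i j j'

end Haar

section Transport

variable {M M' K K' : Type*} [MeasurableSpace K] [MeasurableSpace K'] {A A' : Type} [Fintype A]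
  [DecidableEq A] [Fintype A'] {F : ChannelClass} {N s : ℕ}

/-- The attack that embeds the codespace by the isometry `V`, relabels the messages by `φ` and runs
`𝒜` with the key `g k` in place of `k`. -/
def Attack.transport (𝒜 : Attack M' K' A' F N s) (hF : F.ClosedUnderIsometries) (φ : M ≃ M')
    {g : K → K'} (hg : Measurable g) (V : Matrix A' A ℂ) (hV : Vᴴ * V = 1) :
    Attack M K A F N s where
  M₀ := 𝒜.M₀.map φ.symm.toEmbedding
  card_M₀ := (Finset.card_map _).trans 𝒜.card_M₀
  B := 𝒜.B
  fintypeB := 𝒜.fintypeB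
  decEqB := 𝒜.decEqB
  P i k m := 𝒜.P i (g k) (φ.subtypeEquiv (q := (· ∈ 𝒜.M₀)) (by simp) m)
  isPOVM i k := by
    let := 𝒜.fintypeB
    let := 𝒜.decEqB
    refine ⟨fun m => (𝒜.isPOVM i (g k)).1 _, ?_⟩
    rw [← (𝒜.isPOVM i (g k)).2]
    exact Equiv.sum_comp _ (𝒜.P i (g k))
  measurable_P i m b b' :=
    (𝒜.measurable_P i (φ.subtypeEquiv (q := (· ∈ 𝒜.M₀)) (by simp) m) b b').comp hg
  Φ := letI := 𝒜.fintypeB; 𝒜.Φ.preIsometry V hV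
  mem := letI := 𝒜.fintypeB; hF _ _ _ 𝒜.Φ V hV 𝒜.mem

theorem Attack.score_transport (𝒜 : Attack M' K' A' F N s) (hF : F.ClosedUnderIsometries)
    (φ : M ≃ M') {g : K → K'} (hg : Measurable g) (V : Matrix A' A ℂ) (hV : Vᴴ * V = 1) (k : K)
    (ρ : M → Matrix A A ℂ) :
    (𝒜.transport hF φ hg V hV).score k ρ = 𝒜.score (g k) fun m => conj V (ρ (φ.symm m)) := by
  let := 𝒜.fintypeB
  refine congrArg (1 / (N : ℝ) * ·) ?_
  refine Fintype.sum_equiv (φ.subtypeEquiv (q := (· ∈ 𝒜.M₀)) (by simp [transport])) _ _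
    fun m => ?_
  simp only [Equiv.subtypeEquiv_apply, Equiv.symm_apply_apply]
  rfl

theorem Attack.integral_score_conj_le_cloningValue (𝒜 : Attack M' K' A' F N s)
    (hF : F.ClosedUnderIsometries) (Q : QECM M K A) (φ : M ≃ M') {g : K → K'} (hg : Measurable g)
    {V : Matrix A' A ℂ} (hV : Vᴴ * V = 1) :
    ∫ k, 𝒜.score (g k) (fun m => conj V (Q.cipher k (φ.symm m))) ∂Q.keyDist ≤
      Q.cloningValue F N s := by
  simpa only [Q.attackValue_eq_integral_score, 𝒜.score_transport] using
    Q.attackValue_le_cloningValue (𝒜.transport hF φ hg V hV)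

end Transport

section Averaging

variable {M K : Type*} [MeasurableSpace K] {F : ChannelClass} {N s d : ℕ}

theorem Attack.integral_score_mul_inv_conj (𝒜 : Attack M (unitaryGroup (Fin d) ℂ) (Fin d) F N s)
    (G : unitaryGroup (Fin d) ℂ) (ρ : M → Matrix (Fin d) (Fin d) ℂ) :
    ∫ U, 𝒜.score (U * G⁻¹) (fun m => conj U.1 (ρ m)) ∂haarUnitary d =
      ∫ U, 𝒜.score U (fun m => conj U.1 (conj G.1 (ρ m))) ∂haarUnitary d := by
  rw [← integral_mul_right_eq_self _ G]
  simp only [mul_inv_cancel_right, Submonoid.coe_mul, conj_mul_apply]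

theorem Attack.sum_integral_score_mul_inv_conj {κ : Type*} [Fintype κ]
    (𝒜 : Attack M (unitaryGroup (Fin d) ℂ) (Fin d) F N s) (G : κ → unitaryGroup (Fin d) ℂ)
    {ρ : M → Matrix (Fin d) (Fin d) ℂ} (hρ : ∀ m, IsState (ρ m)) :
    ∑ t, ∫ U, 𝒜.score (U * (G t)⁻¹) (fun m => conj U.1 (ρ m)) ∂haarUnitary d =
      ∫ U, 𝒜.score U (fun m => conj U.1 (∑ t, conj (G t).1 (ρ m))) ∂haarUnitary d := by
  have hint (t : κ) : Integrable
      (fun U => 𝒜.score U fun m => conj U.1 (conj (G t).1 (ρ m))) (haarUnitary d) :=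
    𝒜.integrable_score measurable_id
      (fun m => measurable_conj_apply measurable_unitary_apply fun _ _ => measurable_const)
      fun U m => ((hρ m).conj (mem_unitaryGroup_iff'.mp (G t).2)).conj
        (mem_unitaryGroup_iff'.mp U.2)
  simp only [𝒜.integral_score_mul_inv_conj]
  rw [← integral_finsetSum _ fun t _ => hint t]
  refine integral_congr_ae (.of_forall fun U => ?_)
  dsimp only
  rw [← 𝒜.score_sum]
  congr 1
  ext1 m
  simp only [Finset.sum_apply, map_sum]

theorem Attack.sum_integral_score_eq_mul_attackValue {r n : ℕ} [NeZero r] {κ : Type*} [Fintype κ]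
    (𝒜 : Attack (Fin n) (unitaryGroup (Fin (r * n)) ℂ) (Fin (r * n)) F N s)
    {G : κ → unitaryGroup (Fin (r * n)) ℂ} {ρ : Fin n → Matrix (Fin (r * n)) (Fin (r * n)) ℂ}
    (hρ : ∀ i, IsState (ρ i)) {c : ℝ}
    (hG : ∀ i, ∑ t, conj (G t).1 (ρ i) = c • blockState r n i) :
    ∑ t, ∫ U, 𝒜.score (U * (G t)⁻¹) (fun i => conj U.1 (ρ i)) ∂haarUnitary (r * n) =
      c * (haarEncryption r n).attackValue 𝒜 := by
  rw [𝒜.sum_integral_score_mul_inv_conj G hρ, QECM.attackValue_eq_integral_score,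
    ← integral_const_mul]
  refine integral_congr_ae (.of_forall fun U => ?_)
  dsimp only
  rw [← 𝒜.score_smul]
  congr 1
  ext1 i
  rw [hG, LinearMap.map_smul_of_tower]
  rfl

theorem Attack.integrable_score_prod_haarUnitary
    (𝒜 : Attack M (unitaryGroup (Fin d) ℂ) (Fin d) F N s) {μ : Measure K} [IsFiniteMeasure μ]
    {G : K → unitaryGroup (Fin d) ℂ} (hG : Measurable G) {τ : K → M → Matrix (Fin d) (Fin d) ℂ}
    (hτ : ∀ m i j, Measurable fun k => τ k m i j) (hstate : ∀ k m, IsState (τ k m)) :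
    Integrable (fun z : K × unitaryGroup (Fin d) ℂ =>
      𝒜.score (z.2 * (G z.1)⁻¹) fun m => conj z.2.1 (τ z.1 m)) (μ.prod (haarUnitary d)) :=
  𝒜.integrable_score (measurable_snd.mul (hG.comp measurable_fst).inv)
    (fun m => measurable_conj_apply (fun i j => (measurable_unitary_apply i j).comp measurable_snd)
      fun i j => (hτ m i j).comp measurable_fst)
    fun z m => (hstate z.1 m).conj (mem_unitaryGroup_iff'.mp z.2.2)

theorem QECM.measurable_conj_cipher {A A' : Type} [Fintype A] (Q : QECM M K A) (V : Matrix A' A ℂ)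
    (m : M) (i j : A') : Measurable fun k => conj V (Q.cipher k m) i j :=
  measurable_conj_apply (V := fun _ => V) (X := fun k => Q.cipher k m)
    (fun _ _ => measurable_const) (Q.measurable_cipher m) i j

theorem Attack.integrable_score_conj_cipher_prod {M' : Type*} {A : Type} [Fintype A]
    [DecidableEq A] (𝒜 : Attack M' (unitaryGroup (Fin d) ℂ) (Fin d) F N s) (Q : QECM M K A)
    (φ : M ≃ M') {V : Matrix (Fin d) A ℂ} (hV : Vᴴ * V = 1) {G : K → unitaryGroup (Fin d) ℂ}
    (hG : Measurable G) :
    Integrable (fun z : K × unitaryGroup (Fin d) ℂ => 𝒜.score (z.2 * (G z.1)⁻¹)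
      fun m => conj z.2.1 (conj V (Q.cipher z.1 (φ.symm m)))) (Q.keyDist.prod (haarUnitary d)) := by
  have := Q.isProb
  have hstate (k : K) (m : M') : IsState (conj V (Q.cipher k (φ.symm m))) :=
    (Q.isState k _).conj hV
  exact 𝒜.integrable_score_prod_haarUnitary (τ := fun k m => conj V (Q.cipher k (φ.symm m))) hG
    (fun m => Q.measurable_conj_cipher V (φ.symm m)) hstate

theorem Attack.integral_integral_score_le_cloningValue {M' : Type*} {A : Type} [Fintype A]
    [DecidableEq A] (𝒜 : Attack M' (unitaryGroup (Fin d) ℂ) (Fin d) F N s)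
    (hF : F.ClosedUnderIsometries) (Q : QECM M K A) (φ : M ≃ M') {V : Matrix (Fin d) A ℂ}
    (hV : Vᴴ * V = 1) {G : K → unitaryGroup (Fin d) ℂ} (hG : Measurable G) :
    ∫ k, ∫ U, 𝒜.score (U * (G k)⁻¹) (fun m => conj U.1 (conj V (Q.cipher k (φ.symm m))))
      ∂haarUnitary d ∂Q.keyDist ≤ Q.cloningValue F N s := by
  have := Q.isProb
  have hle (U : unitaryGroup (Fin d) ℂ) : ∫ k, 𝒜.score (U * (G k)⁻¹)
      (fun m => conj U.1 (conj V (Q.cipher k (φ.symm m)))) ∂Q.keyDist ≤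
        Q.cloningValue F N s := by
    have hUV : (U.1 * V)ᴴ * (U.1 * V) = 1 := by
      rw [conjTranspose_mul, Matrix.mul_assoc, ← Matrix.mul_assoc _ _ V,
        show U.1ᴴ * U.1 = 1 from mem_unitaryGroup_iff'.mp U.2, Matrix.one_mul, hV]
    simpa only [conj_mul_apply, Pi.inv_apply] using
      𝒜.integral_score_conj_le_cloningValue hF Q φ (hG.inv.const_mul U) hUV
  have hint := 𝒜.integrable_score_conj_cipher_prod Q φ hV hG
  rw [integral_integral_swap hint]
  simpa using integral_mono hint.integral_prod_right (integrable_const _) hle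

theorem Attack.attackValue_haarEncryption_le_cloningValue {n r : ℕ} [NeZero r] {A : Type}
    [Fintype A] [DecidableEq A]
    (𝒜 : Attack (Fin n) (unitaryGroup (Fin (r * n)) ℂ) (Fin (r * n)) F N s)
    (hF : F.ClosedUnderIsometries) (Q : QECM M K A) (φ : M ≃ Fin n)
    {V : Matrix (Fin (r * n)) A ℂ} (hV : Vᴴ * V = 1) {G : K → Fin r → unitaryGroup (Fin (r * n)) ℂ}
    (hG : ∀ t, Measurable fun k => G k t)
    (hmix : ∀ᵐ k ∂Q.keyDist, ∀ i, ∑ t, conj (G k t).1 (conj V (Q.cipher k (φ.symm i))) =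
      (r : ℝ) • blockState r n i) :
    (haarEncryption r n).attackValue 𝒜 ≤ Q.cloningValue F N s := by
  have := Q.isProb
  let f (t : Fin r) (k : K) (U : unitaryGroup (Fin (r * n)) ℂ) : ℝ :=
    𝒜.score (U * (G k t)⁻¹) fun i => conj U.1 (conj V (Q.cipher k (φ.symm i)))
  have hstate (k : K) (i : Fin n) : IsState (conj V (Q.cipher k (φ.symm i))) :=
    (Q.isState k _).conj hV
  refine le_of_mul_le_mul_left ?_ (Nat.cast_pos.mpr (NeZero.pos r) : (0 : ℝ) < r)
  calc (r : ℝ) * (haarEncryption r n).attackValue 𝒜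
      = ∫ _k, (r : ℝ) * (haarEncryption r n).attackValue 𝒜 ∂Q.keyDist := by simp
    _ = ∫ k, ∑ t, ∫ U, f t k U ∂haarUnitary (r * n) ∂Q.keyDist := by
        refine integral_congr_ae (hmix.mono fun k hk => ?_)
        exact (𝒜.sum_integral_score_eq_mul_attackValue (hstate k) hk).symm
    _ = ∑ t, ∫ k, ∫ U, f t k U ∂haarUnitary (r * n) ∂Q.keyDist :=
        integral_finsetSum _ fun t _ =>
          (𝒜.integrable_score_conj_cipher_prod Q φ hV (hG t)).integral_prod_left
    _ ≤ ∑ _t : Fin r, Q.cloningValue F N s := Finset.sum_le_sum fun t _ =>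
        𝒜.integral_integral_score_le_cloningValue hF Q φ hV (hG t)
    _ = r * Q.cloningValue F N s := by simp

theorem QECM.IsCorrect.exists_measurable_unitary_sum_conj_eq {n r : ℕ} [NeZero r] [Fintype M]
    {A : Type} [Fintype A] [DecidableEq A] {Q : QECM M K A} (hQ : Q.IsCorrect)
    (hrank : ∀ᵐ k ∂Q.keyDist, ∀ m, (Q.cipher k m).rank ≤ r) (φ : M ≃ Fin n)
    {V : Matrix (Fin (r * n)) A ℂ} (hV : Vᴴ * V = 1) :
    ∃ G : K → Fin r → unitaryGroup (Fin (r * n)) ℂ, (∀ t, Measurable fun k => G k t) ∧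
      ∀ᵐ k ∂Q.keyDist, ∀ i, ∑ t, conj (G k t).1 (conj V (Q.cipher k (φ.symm i))) =
        (r : ℝ) • blockState r n i := by
  obtain ⟨G, hG, hG_sum⟩ := QEnc.exists_measurable_unitary_sum_conj_eq (κ := Fin r)
    (τ := fun k i => conj V (Q.cipher k (φ.symm i)))
    (fun i => Q.measurable_conj_cipher V (φ.symm i)) fun i => (r : ℝ) • blockState r n i
  refine ⟨G, hG, ?_⟩
  filter_upwards [hQ.ae_orthogonal, hrank] with k hk_orth hk_rank
  refine hG_sum k <| exists_unitary_sum_conj_eq_smul_blockState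
    (fun i => (Q.isState k _).conj hV) (fun i j hij => ?_) fun i => ?_
  · dsimp only
    rw [conj_mul_conj hV, hk_orth (φ.symm.injective.ne hij), map_zero]
  · exact (rank_conj_le V _).trans (hk_rank _)

end Averaging

end QEnc

theorem mainTheorem9_general {M K : Type*} [Fintype M] [MeasurableSpace K]
    {A : Type} [Fintype A] [DecidableEq A]
    (Q : QEnc.QECM M K A) (hQ : Q.IsCorrect) (r : ℕ) [NeZero r]
    (hrank : ∀ᵐ k ∂Q.keyDist, ∀ m, (Q.cipher k m).rank ≤ r)
    (hdim : Nonempty M → Fintype.card A ≤ r * Fintype.card M)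
    (F : QEnc.ChannelClass) (hF : F.ClosedUnderIsometries) (N s : ℕ) :
    (QEnc.haarEncryption r (Fintype.card M)).cloningValue F N s ≤ Q.cloningValue F N s := by
  rcases isEmpty_or_nonempty M with hM | hM
  · have : IsEmpty (Fin (Fintype.card M)) := (Fintype.equivFin M).symm.isEmpty
    exact (QEnc.QECM.cloningValue_of_isEmpty _).trans_le Q.cloningValue_nonneg
  · obtain ⟨V, hV⟩ := QEnc.exists_isometry (A' := Fin (r * Fintype.card M))
      ((hdim hM).trans_eq (Fintype.card_fin _).symm)
    let φ := Fintype.equivFin M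
    obtain ⟨G, hG, hmix⟩ := hQ.exists_measurable_unitary_sum_conj_eq hrank φ hV
    exact Real.iSup_le
      (fun 𝒜 => 𝒜.attackValue_haarEncryption_le_cloningValue hF Q φ hV hG hmix)
      Q.cloningValue_nonneg

theorem mainTheorem9 {M K : Type*} [Fintype M] [MeasurableSpace K]
    {A : Type} [Fintype A] [DecidableEq A]
    (Q : QEnc.QECM M K A) (hQ : Q.IsCorrect)
    (F : QEnc.ChannelClass) (hF : F.ClosedUnderIsometries) (N s : ℕ) :
    (QEnc.haarEncryption (Fintype.card A - Fintype.card M + 1) (Fintype.card M)).cloningValue F N s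
      ≤ Q.cloningValue F N s :=
  mainTheorem9_general Q hQ _ hQ.ae_rank_le (fun _ => hQ.card_le_mul_card) F hF N s
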